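/- Let $A$ and $B$ be complex $n\times n$ density matrices (positive semidefinite matrices of trace one) with $\operatorname{supp}A\subseteq\operatorname{supp}B$, where the support of a Hermitian matrix is the orthogonal complement of its kernel. For $t\in(0,1)$ let $$S_t(A|B)=\frac{1}{t-1}\,\ln\operatorname{tr}\Big(B^{\frac{1-t}{2t}}\,A\,B^{\frac{1-t}{2t}}\Big)^{t}$$ be the sandwiched Rényi relative entropy of $A$ with respect to $B$, and let $D(A|B)=\operatorname{tr}A(\ln A-\ln B)$ be the relative entropy, where the logarithm of a positive semidefinite matrix is taken on its support and extended by $0$ to its kernel. Then $$\lim_{t\to1-}S_t(A|B)=D(A|B).$$ -/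

import Mathlib

noncomputable section

namespace QuantumEntropy

open scoped ComplexOrder

/-- A density matrix: a positive semidefinite complex matrix of trace one. -/
structure IsDensityMatrix {n : ℕ} (A : Matrix (Fin n) (Fin n) ℂ) : Prop where
  posSemidef : A.PosSemidef
  trace_eq_one : A.trace = 1

/-- The support of a (Hermitian) matrix: the orthogonal complement in `ℂⁿ` of its kernel. -/
def supp {n : ℕ} (A : Matrix (Fin n) (Fin n) ℂ) : Submodule ℂ (EuclideanSpace ℂ (Fin n)) :=
  (LinearMap.ker (Matrix.toEuclideanLin A))ᗮ

/-- The real power `A ^ s` of a positive semidefinite matrix, by spectral calculus. -/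
def mpow {n : ℕ} (A : Matrix (Fin n) (Fin n) ℂ) (s : ℝ) : Matrix (Fin n) (Fin n) ℂ :=
  cfc (fun x : ℝ => x ^ s) A

/-- The logarithm of a positive semidefinite matrix, by spectral calculus. Since
`Real.log 0 = 0`, this is the logarithm taken on the support and extended by `0` to the kernel,
as in the usual convention for the entropy of singular density matrices. -/
def mlog {n : ℕ} (A : Matrix (Fin n) (Fin n) ℂ) : Matrix (Fin n) (Fin n) ℂ :=
  cfc Real.log A

/-- The relative entropy `D(A|B) = tr A (ln A - ln B)`, for `supp A ⊆ supp B`. The trace is a real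
number, being that of a product of two Hermitian matrices. -/
def relEntropy {n : ℕ} (A B : Matrix (Fin n) (Fin n) ℂ) : ℝ :=
  (A * (mlog A - mlog B)).trace.re

/-- The sandwiched quasi-relative entropy
`tr (B^((1-t)/(2t)) A B^((1-t)/(2t)))^t`. The trace is a real number, the matrix being positive
semidefinite. -/
def sandwichedQuasi {n : ℕ} (t : ℝ) (A B : Matrix (Fin n) (Fin n) ℂ) : ℝ :=
  (mpow (mpow B ((1 - t) / (2 * t)) * A * mpow B ((1 - t) / (2 * t))) t).trace.re

/-- The sandwiched Rényi relative entropy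
`S_t(A|B) = ln (tr (B^((1-t)/(2t)) A B^((1-t)/(2t)))^t) / (t - 1)`. -/
def sandwichedRenyi {n : ℕ} (t : ℝ) (A B : Matrix (Fin n) (Fin n) ℂ) : ℝ :=
  Real.log (sandwichedQuasi t A B) / (t - 1)

end QuantumEntropy

end

namespace QuantumEntropy

open Filter Topology Matrix
open scoped ComplexOrder

/-! ### Real-variable limits as `t → 1⁻`. -/

section Scalar

/-! Since `Q_1 = tr A = 1`, `S_t` is the slope of `ln Q_t` at `1`, so its limit is the left
derivative of the trace `Q_t`. Put `X_t = B^s A B^s` with `s = (1-t)/(2t)`, and split `(Q_t - tr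
A)/(t-1)` as `(tr X_t^t - tr X_t)/(t-1) + (tr X_t - tr A)/(t-1)`. The first term tends to `tr A ln
A` (`tendsto_trace_rpow_quotient`): scalar quotients converge uniformly on compact intervals and
`X_t → A`, so no eigenvalue of `X_t` is differentiated. The second involves only powers of `B`, by
cyclicity, and tends to `-tr A ln B` (`tendsto_trace_conj_mpow_quotient`). The support hypothesis
enters as `P A = A = A P`, `P` being the support projection of `B`. -/

/-- The difference quotient at `t = 1` of `t ↦ x ^ t` is uniformly close to `x log x`. -/
lemma abs_rpow_quotient_sub_mul_log_le {t x : ℝ} (ht : 1 / 2 ≤ t) (ht1 : t < 1) (hx : 0 ≤ x) :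
    |(x ^ t - x) / (t - 1) - x * Real.log x| ≤
      (1 - t) * ((x + √x) * Real.log x ^ 2) := by
  rcases hx.eq_or_lt with rfl | hx
  · simp [Real.zero_rpow (show t ≠ 0 by linarith)]
  set L := Real.log x with hL
  have hu : 0 < 1 - t := by linarith
  have hxt : x ^ t = x * Real.exp (-((1 - t) * L)) := by
    have h : Real.exp L = x := Real.exp_log hx
    rw [Real.rpow_def_of_pos hx, ← hL, ← h, ← Real.exp_add]
    ring_nf
  have hq : (x ^ t - x) / (t - 1) = (x - x ^ t) / (1 - t) := by
    rw [← neg_div_neg_eq]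
    ring_nf
  have hx' : x = x ^ t * Real.exp ((1 - t) * L) := by
    rw [hxt, mul_assoc, ← Real.exp_add]
    simp
  have hpos : 0 < x ^ t := Real.rpow_pos_of_pos hx t
  have upper : (x - x ^ t) / (1 - t) ≤ x * L := by
    rw [div_le_iff₀ hu]
    have := mul_le_mul_of_nonneg_left (Real.add_one_le_exp (-((1 - t) * L))) hx.le
    rw [← hxt] at this
    linarith
  have lower : x ^ t * L ≤ (x - x ^ t) / (1 - t) := by
    rw [le_div_iff₀ hu]
    have := mul_le_mul_of_nonneg_left (Real.add_one_le_exp ((1 - t) * L)) hpos.le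
    rw [← hx'] at this
    linarith
  have key : x * L - x ^ t * L ≤ (1 - t) * ((x + √x) * L ^ 2) := by
    have h₁ : x - x ^ t ≤ x * ((1 - t) * L) := by
      have := (div_le_iff₀ hu).1 upper
      linarith
    have h₂ : x ^ t * ((1 - t) * L) ≤ x - x ^ t := by
      have := (le_div_iff₀ hu).1 lower
      linarith
    -- For `L ≥ 0` the factor `x` suffices; for `L ≤ 0`, `t ≥ 1/2` gives `x ^ t ≤ √x`, a bound free
    -- of `t`.
    rcases le_total 0 L with h | h
    · have h₃ := mul_le_mul_of_nonneg_right h₁ h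
      have h₄ : 0 ≤ (1 - t) * (√x * L ^ 2) := by positivity
      nlinarith
    · have h₃ := mul_le_mul_of_nonpos_right h₂ h
      have hx1 : x ≤ 1 := (Real.log_nonpos_iff hx.le).1 h
      have h₄ : x ^ t ≤ √x := by
        rw [Real.sqrt_eq_rpow]
        exact Real.rpow_le_rpow_of_exponent_ge hx hx1 ht
      have h₅ := mul_le_mul_of_nonneg_left h₄ (show 0 ≤ (1 - t) * L ^ 2 by positivity)
      have h₆ : 0 ≤ (1 - t) * (x * L ^ 2) := by positivity
      nlinarith
  rw [hq, abs_le]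
  constructor <;> linarith

/-- Continuity at `0` comes from that of `y log y`, taken at `y = √x` and `y = √√x`. -/
lemma continuousOn_add_sqrt_mul_log_sq :
    ContinuousOn (fun x : ℝ => (x + √x) * Real.log x ^ 2) (Set.Ici 0) := by
  have h : Set.EqOn (fun x : ℝ => (x + √x) * Real.log x ^ 2)
      (fun x => (2 * (√x * Real.log √x)) ^ 2 + (4 * (√√x * Real.log √√x)) ^ 2)
      (Set.Ici 0) := by
    intro x hx
    have hx : 0 ≤ x := hx
    have h₁ := Real.sq_sqrt hx
    have h₂ := Real.sq_sqrt (Real.sqrt_nonneg x)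
    simp only [Real.log_sqrt (Real.sqrt_nonneg x), Real.log_sqrt hx, mul_pow, h₁, h₂]
    ring
  refine ContinuousOn.congr (Continuous.continuousOn ?_) h
  have hc := Real.continuous_mul_log
  have h₁ : Continuous fun x : ℝ => √x * Real.log √x := hc.comp Real.continuous_sqrt
  have h₂ : Continuous fun x : ℝ => √√x * Real.log √√x := h₁.comp Real.continuous_sqrt
  fun_prop

lemma tendstoUniformlyOn_rpow_quotient (M : ℝ) :
    TendstoUniformlyOn (fun t x : ℝ => (x ^ t - x) / (t - 1)) (fun x => x * Real.log x)
      (𝓝[<] 1) (Set.Icc 0 M) := by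
  obtain ⟨C, hC⟩ := (isCompact_Icc (a := (0 : ℝ)) (b := M)).exists_bound_of_continuousOn
    (continuousOn_add_sqrt_mul_log_sq.mono Set.Icc_subset_Ici_self)
  rw [Metric.tendstoUniformlyOn_iff]
  intro ε hε
  have hlim : Tendsto (fun t : ℝ => (1 - t) * C) (𝓝[<] 1) (𝓝 0) := by
    have : Continuous fun t : ℝ => (1 - t) * C := by fun_prop
    simpa using (this.tendsto 1).mono_left nhdsWithin_le_nhds
  filter_upwards [hlim.eventually_lt_const hε, self_mem_nhdsWithin,
    nhdsWithin_le_nhds (Ioi_mem_nhds (show (1 / 2 : ℝ) < 1 by norm_num))] with t ht ht1 ht2 x hx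
  rw [dist_comm, Real.dist_eq]
  refine (abs_rpow_quotient_sub_mul_log_le (le_of_lt ht2) ht1 hx.1).trans_lt (lt_of_le_of_lt ?_ ht)
  have ht1 : t < 1 := ht1
  exact mul_le_mul_of_nonneg_left ((le_abs_self _).trans (hC x hx)) (by linarith)

/-- The exponent has derivative `-1/2` at `1`, and there are two factors. At `x = 0` the exponent is
positive for `0 < t < 1`, so the quotient vanishes, in accord with `Real.log 0 = 0`. -/
lemma tendsto_rpow_mul_rpow_quotient {x : ℝ} (hx : 0 ≤ x) :
    Tendsto (fun t : ℝ => (x ^ ((1 - t) / (2 * t)) * x ^ ((1 - t) / (2 * t)) -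
      if x = 0 then 0 else 1) / (t - 1)) (𝓝[<] 1) (𝓝 (-Real.log x)) := by
  rcases hx.eq_or_lt with rfl | hx
  · simp only [if_true, Real.log_zero, neg_zero]
    refine tendsto_const_nhds.congr' ?_
    filter_upwards [self_mem_nhdsWithin,
      nhdsWithin_le_nhds (Ioi_mem_nhds (show (0 : ℝ) < 1 by norm_num))] with t ht ht0
    have ht : t < 1 := ht
    have ht0 : 0 < t := ht0
    have : (1 - t) / (2 * t) ≠ 0 := (div_pos (by linarith) (by linarith)).ne'
    simp [Real.zero_rpow this]
  · have hs : HasDerivAt (fun t : ℝ => (1 - t) / (2 * t)) (-1 / 2) 1 := by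
      have := ((hasDerivAt_id (1 : ℝ)).const_sub 1).div ((hasDerivAt_id (1 : ℝ)).const_mul 2)
        (by norm_num)
      convert! this using 1
      norm_num
    have h := (hs.const_rpow hx).mul (hs.const_rpow hx)
    have h' := (hasDerivWithinAt_iff_tendsto_slope' (s := Set.Iio 1) (by simp)).1
      h.hasDerivWithinAt
    convert! h' using 1
    · ext t
      simp [slope_def_field, hx.ne']
    · simp
      ring_nf

lemma tendsto_rpow_support {x : ℝ} (hx : 0 ≤ x) :
    Tendsto (fun t : ℝ => x ^ ((1 - t) / (2 * t))) (𝓝[<] 1) (𝓝 (if x = 0 then 0 else 1)) := by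
  rcases hx.eq_or_lt with rfl | hx
  · simp only [if_true]
    refine tendsto_const_nhds.congr' ?_
    filter_upwards [self_mem_nhdsWithin,
      nhdsWithin_le_nhds (Ioi_mem_nhds (show (0 : ℝ) < 1 by norm_num))] with t ht ht0
    have ht : t < 1 := ht
    have ht0 : 0 < t := ht0
    have : (1 - t) / (2 * t) ≠ 0 := (div_pos (by linarith) (by linarith)).ne'
    simp [Real.zero_rpow this]
  · have h : ContinuousAt (fun t : ℝ => x ^ ((1 - t) / (2 * t))) 1 := by
      refine ContinuousAt.rpow continuousAt_const ?_ (Or.inl hx.ne')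
      exact ContinuousAt.div (by fun_prop) (by fun_prop) (by norm_num)
    simpa [hx.ne'] using h.tendsto.mono_left nhdsWithin_le_nhds

end Scalar

/-! ### Functional calculus along convergent matrices. -/

section Calculus

variable {n : ℕ} {A B : Matrix (Fin n) (Fin n) ℂ}

lemma continuousOn_real_spectrum (f : ℝ → ℝ) (A : Matrix (Fin n) (Fin n) ℂ) :
    ContinuousOn f (spectrum ℝ A) :=
  Matrix.finite_real_spectrum.continuousOn f

lemma isHermitian_cfc (f : ℝ → ℝ) (A : Matrix (Fin n) (Fin n) ℂ) : (cfc f A).IsHermitian :=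
  cfc_predicate (p := IsSelfAdjoint) f A

lemma cfc_id_of_isHermitian (hA : A.IsHermitian) : cfc (fun x : ℝ => x) A = A :=
  cfc_id' ℝ A hA.isSelfAdjoint

lemma cfc_mul_cfc (f g : ℝ → ℝ) (A : Matrix (Fin n) (Fin n) ℂ) :
    cfc f A * cfc g A = cfc (fun x => f x * g x) A :=
  (cfc_mul f g A (continuousOn_real_spectrum f A) (continuousOn_real_spectrum g A)).symm

lemma trace_cfc (hA : A.IsHermitian) (f : ℝ → ℝ) :
    (cfc f A).trace = ∑ i, (f (hA.eigenvalues i) : ℂ) := by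
  rw [hA.cfc_eq, IsHermitian.cfc, Unitary.conjStarAlgAut_apply, trace_mul_cycle,
    Unitary.coe_star_mul_self, one_mul, trace_diagonal]
  rfl

/-- On a fixed matrix the functional calculus is continuous for pointwise convergence. -/
lemma tendsto_cfc_of_forall_eigenvalues {α : Type*} {l : Filter α} {F : α → ℝ → ℝ} {f : ℝ → ℝ}
    (hA : A.IsHermitian)
    (h : ∀ i, Tendsto (fun a => F a (hA.eigenvalues i)) l (𝓝 (f (hA.eigenvalues i)))) :
    Tendsto (fun a => cfc (F a) A) l (𝓝 (cfc f A)) := by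
  simp only [hA.cfc_eq, IsHermitian.cfc, Unitary.conjStarAlgAut_apply]
  have hd : Tendsto (fun a => diagonal (RCLike.ofReal ∘ F a ∘ hA.eigenvalues : Fin n → ℂ)) l
      (𝓝 (diagonal (RCLike.ofReal ∘ f ∘ hA.eigenvalues))) := by
    refine (Continuous.matrix_diagonal continuous_id).continuousAt.tendsto.comp ?_
    rw [tendsto_pi_nhds]
    exact fun i => (RCLike.continuous_ofReal.tendsto _).comp (h i)
  exact (hd.const_mul _).mul_const _

open scoped Matrix.Norms.L2Operator in
lemma tendsto_cfc_of_tendsto {α : Type*} {l : Filter α} {X : α → Matrix (Fin n) (Fin n) ℂ}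
    {s : Set ℝ} (hs : IsCompact s) {f : ℝ → ℝ} (hf : ContinuousOn f s)
    (hX : Tendsto X l (𝓝 A)) (hXs : ∀ᶠ a in l, spectrum ℝ (X a) ⊆ s)
    (hXh : ∀ᶠ a in l, (X a).IsHermitian) (hAs : spectrum ℝ A ⊆ s) (hA : A.IsHermitian) :
    Tendsto (fun a => cfc f (X a)) l (𝓝 (cfc f A)) :=
  Filter.Tendsto.cfc hs f hX hXs hXh hAs hA hf

lemma spectrum_subset_Icc_trace (hA : A.PosSemidef) :
    spectrum ℝ A ⊆ Set.Icc 0 A.trace.re := by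
  rw [hA.1.spectrum_real_eq_range_eigenvalues]
  rintro _ ⟨i, rfl⟩
  refine ⟨hA.eigenvalues_nonneg i, ?_⟩
  rw [hA.1.trace_eq_sum_eigenvalues]
  simpa using Finset.single_le_sum (fun j _ => hA.eigenvalues_nonneg j) (Finset.mem_univ i)

lemma tendsto_trace_rpow_quotient {X : ℝ → Matrix (Fin n) (Fin n) ℂ}
    (hA : A.PosSemidef) (hX : Tendsto X (𝓝[<] 1) (𝓝 A)) (hXp : ∀ t, (X t).PosSemidef) :
    Tendsto (fun t => ((mpow (X t) t).trace.re - (X t).trace.re) / (t - 1)) (𝓝[<] 1)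
      (𝓝 (A * mlog A).trace.re) := by
  set M := A.trace.re + 1
  have htr : Tendsto (fun t => (X t).trace.re) (𝓝[<] 1) (𝓝 A.trace.re) :=
    (Complex.continuous_re.tendsto _).comp
      (((continuous_id.matrix_trace).tendsto A).comp hX)
  have hXs : ∀ᶠ t in 𝓝[<] 1, spectrum ℝ (X t) ⊆ Set.Icc 0 M := by
    filter_upwards [htr.eventually_le_const (show A.trace.re < M by simp [M])] with t ht
    exact (spectrum_subset_Icc_trace (hXp t)).trans (Set.Icc_subset_Icc_right ht)
  have hAs : spectrum ℝ A ⊆ Set.Icc 0 M :=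
    (spectrum_subset_Icc_trace hA).trans (Set.Icc_subset_Icc_right (by simp [M]))
  have hlim : Tendsto (fun t => (cfc (fun x => x * Real.log x) (X t)).trace.re) (𝓝[<] 1)
      (𝓝 (cfc (fun x => x * Real.log x) A).trace.re) :=
    (Complex.continuous_re.tendsto _).comp (((continuous_id.matrix_trace).tendsto _).comp
      (tendsto_cfc_of_tendsto isCompact_Icc Real.continuous_mul_log.continuousOn hX hXs
        (.of_forall fun t => (hXp t).1) hAs hA.1))
  have hlog : cfc (fun x => x * Real.log x) A = A * mlog A := by
    rw [← cfc_mul_cfc, cfc_id_of_isHermitian hA.1, mlog]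
  rw [hlog] at hlim
  have hdiff : Tendsto (fun t => ((mpow (X t) t).trace.re - (X t).trace.re) / (t - 1) -
      (cfc (fun x => x * Real.log x) (X t)).trace.re) (𝓝[<] 1) (𝓝 0) := by
    rw [Metric.tendsto_nhds]
    intro ε hε
    -- `n + 1` keeps the final bound strict and covers `n = 0`.
    have hδ : 0 < ε / (n + 1) := by positivity
    filter_upwards [hXs, Metric.tendstoUniformlyOn_iff.1 (tendstoUniformlyOn_rpow_quotient M) _ hδ]
      with t hts ht
    have hh := (hXp t).1
    have heq : ((mpow (X t) t).trace.re - (X t).trace.re) / (t - 1) -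
        (cfc (fun x => x * Real.log x) (X t)).trace.re =
        ∑ i, ((hh.eigenvalues i ^ t - hh.eigenvalues i) / (t - 1) -
          hh.eigenvalues i * Real.log (hh.eigenvalues i)) := by
      rw [mpow, trace_cfc hh, trace_cfc hh, hh.trace_eq_sum_eigenvalues]
      simp only [Complex.re_sum, Complex.ofReal_re, Complex.coe_algebraMap,
        Finset.sum_sub_distrib, ← Finset.sum_div]
    rw [dist_zero_right, heq]
    calc _ ≤ ∑ i : Fin n, ε / (n + 1) := by
          refine (norm_sum_le _ _).trans (Finset.sum_le_sum fun i _ => ?_)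
          have := ht _ (hts (hh.eigenvalues_mem_spectrum_real i))
          rw [dist_comm, Real.dist_eq] at this
          exact this.le
      _ < ε := by
          rw [Finset.sum_const, Finset.card_univ, Fintype.card_fin, nsmul_eq_mul, ← mul_div_assoc,
            div_lt_iff₀ (by positivity)]
          nlinarith
  simpa using hdiff.add hlim

end Calculus

/-! ### The support projection and the linear term. -/

section Support

variable {n : ℕ} {A B : Matrix (Fin n) (Fin n) ℂ}

/-- The orthogonal projection onto the support of a Hermitian matrix. -/
noncomputable def suppProj (B : Matrix (Fin n) (Fin n) ℂ) : Matrix (Fin n) (Fin n) ℂ :=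
  cfc (fun x : ℝ => if x = 0 then 0 else 1) B

lemma mul_suppProj_self (hB : B.IsHermitian) : B * suppProj B = B := by
  calc B * suppProj B = cfc (fun x : ℝ => x * if x = 0 then 0 else 1) B := by
        rw [← cfc_mul_cfc, cfc_id_of_isHermitian hB, suppProj]
    _ = cfc (fun x : ℝ => x) B := by
        congr 1
        ext x
        by_cases hx : x = 0 <;> simp [hx]
    _ = B := cfc_id_of_isHermitian hB

lemma mulVec_eq_zero_of_supp_le (hAB : supp A ≤ supp B) {v : Fin n → ℂ} (hv : B *ᵥ v = 0) :
    A *ᵥ v = 0 := by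
  -- Complements turn the inclusion of supports into `ker B ≤ ker A`.
  have h := Submodule.orthogonal_le hAB
  rw [supp, supp, Submodule.orthogonal_orthogonal, Submodule.orthogonal_orthogonal] at h
  have hmem : WithLp.toLp 2 v ∈ LinearMap.ker (Matrix.toEuclideanLin B) := by
    rw [LinearMap.mem_ker, Matrix.toLpLin_apply]
    simp [hv]
  have := h hmem
  rw [LinearMap.mem_ker, Matrix.toLpLin_apply] at this
  simpa using this

lemma mul_suppProj (hB : B.IsHermitian) (hAB : supp A ≤ supp B) : A * suppProj B = A := by
  have h : A * (1 - suppProj B) = 0 := by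
    ext i j
    have hB0 : B *ᵥ (fun k => (1 - suppProj B) k j) = 0 := by
      have h0 : B * (1 - suppProj B) = 0 := by rw [mul_sub, mul_one, mul_suppProj_self hB, sub_self]
      ext i
      exact congrFun (congrFun h0 i) j
    exact congrFun (mulVec_eq_zero_of_supp_le hAB hB0) i
  rw [mul_sub, mul_one, sub_eq_zero] at h
  exact h.symm

lemma suppProj_mul (hA : A.IsHermitian) (hB : B.IsHermitian) (hAB : supp A ≤ supp B) :
    suppProj B * A = A := by
  have h := congrArg conjTranspose (mul_suppProj hB hAB)
  have hP : (suppProj B).IsHermitian := isHermitian_cfc _ B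
  rwa [conjTranspose_mul, hA.eq, hP.eq] at h

lemma tendsto_mpow_suppProj (hB : B.PosSemidef) :
    Tendsto (fun t : ℝ => mpow B ((1 - t) / (2 * t))) (𝓝[<] 1) (𝓝 (suppProj B)) :=
  tendsto_cfc_of_forall_eigenvalues hB.1 fun i => tendsto_rpow_support (hB.eigenvalues_nonneg i)

lemma tendsto_conj_mpow (hA : A.IsHermitian) (hB : B.PosSemidef) (hAB : supp A ≤ supp B) :
    Tendsto (fun t : ℝ => mpow B ((1 - t) / (2 * t)) * A * mpow B ((1 - t) / (2 * t)))
      (𝓝[<] 1) (𝓝 A) := by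
  have h := ((tendsto_mpow_suppProj hB).mul_const A).mul (tendsto_mpow_suppProj hB)
  rwa [suppProj_mul hA hB.1 hAB, mul_suppProj hB.1 hAB] at h

/-- As `A P = A`, cyclicity makes the quotient the trace of `A` times a function of the fixed matrix
`B`. -/
lemma tendsto_trace_conj_mpow_quotient (hB : B.PosSemidef)
    (hAB : supp A ≤ supp B) :
    Tendsto (fun t : ℝ => ((mpow B ((1 - t) / (2 * t)) * A *
      mpow B ((1 - t) / (2 * t))).trace.re - A.trace.re) / (t - 1)) (𝓝[<] 1)
      (𝓝 (-(A * mlog B).trace.re)) := by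
  have h := tendsto_cfc_of_forall_eigenvalues (l := 𝓝[<] (1 : ℝ)) (f := fun x => -Real.log x)
    (F := fun t x => (x ^ ((1 - t) / (2 * t)) * x ^ ((1 - t) / (2 * t)) -
      if x = 0 then 0 else 1) / (t - 1)) hB.1
    fun i => tendsto_rpow_mul_rpow_quotient (hB.eigenvalues_nonneg i)
  have h' := (Complex.continuous_re.tendsto _).comp
    (((continuous_id.matrix_trace).tendsto _).comp (h.const_mul A))
  convert! h' using 1
  · ext t
    have hF : cfc (fun x : ℝ => (x ^ ((1 - t) / (2 * t)) * x ^ ((1 - t) / (2 * t)) -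
        if x = 0 then 0 else 1) / (t - 1)) B = (t - 1)⁻¹ • (mpow B ((1 - t) / (2 * t)) *
          mpow B ((1 - t) / (2 * t)) - suppProj B) := by
      have hc := fun f : ℝ → ℝ => continuousOn_real_spectrum f B
      rw [mpow, suppProj, cfc_mul_cfc, ← cfc_sub _ _ B (hc _) (hc _),
        ← cfc_smul _ _ B (hc _)]
      simp only [div_eq_inv_mul, smul_eq_mul]
    simp only [Function.comp_apply, id, hF, mul_smul_comm, mul_sub, mul_suppProj hB.1 hAB,
      trace_smul, trace_sub, Complex.smul_re, Complex.sub_re, smul_eq_mul]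
    rw [trace_mul_cycle, trace_mul_comm, div_eq_inv_mul, mul_sub]
  · rw [cfc_neg, ← mlog]
    simp

end Support

/-- With `0 ^ 0 = 1`, `mpow B 0` is the identity rather than the support projection, so no support
condition is needed. -/
lemma sandwichedQuasi_one {n : ℕ} {A : Matrix (Fin n) (Fin n) ℂ} (hA : A.IsHermitian)
    {B : Matrix (Fin n) (Fin n) ℂ} (hB : B.IsHermitian) :
    sandwichedQuasi 1 A B = A.trace.re := by
  have h1 : mpow B 0 = 1 := by
    simp only [mpow, Real.rpow_zero]
    exact cfc_const_one ℝ B hB.isSelfAdjoint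
  have h2 : mpow A 1 = A := by
    simp only [mpow, Real.rpow_one]
    exact cfc_id_of_isHermitian hA
  simp [sandwichedQuasi, h1, h2]

lemma hasDerivWithinAt_sandwichedQuasi {n : ℕ} {A B : Matrix (Fin n) (Fin n) ℂ}
    (hA : A.PosSemidef) (hB : B.PosSemidef) (hAB : supp A ≤ supp B) :
    HasDerivWithinAt (fun t => sandwichedQuasi t A B) (relEntropy A B) (Set.Iio 1) 1 := by
  rw [hasDerivWithinAt_iff_tendsto_slope' (by simp)]
  have hX : ∀ t : ℝ, (mpow B ((1 - t) / (2 * t)) * A * mpow B ((1 - t) / (2 * t))).PosSemidef := by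
    intro t
    have h := hA.conjTranspose_mul_mul_same (mpow B ((1 - t) / (2 * t)))
    have hP : (mpow B ((1 - t) / (2 * t))).IsHermitian := isHermitian_cfc _ B
    rwa [hP.eq] at h
  have h := (tendsto_trace_rpow_quotient hA (tendsto_conj_mpow hA.1 hB hAB) hX).add
    (tendsto_trace_conj_mpow_quotient hB hAB)
  convert! h using 1
  · ext t
    rw [slope_def_field, sandwichedQuasi_one hA.1 hB.1, sandwichedQuasi]
    ring
  · rw [relEntropy, mul_sub, trace_sub, Complex.sub_re, sub_eq_add_neg]

end QuantumEntropy

theorem theoremt8 {n : ℕ} (A B : Matrix (Fin n) (Fin n) ℂ)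
    (hA : QuantumEntropy.IsDensityMatrix A) (hB : QuantumEntropy.IsDensityMatrix B)
    (hAB : QuantumEntropy.supp A ≤ QuantumEntropy.supp B) :
    Filter.Tendsto (fun t : ℝ => QuantumEntropy.sandwichedRenyi t A B)
      (nhdsWithin (1 : ℝ) (Set.Iio 1)) (nhds (QuantumEntropy.relEntropy A B)) := by
  have h1 : QuantumEntropy.sandwichedQuasi 1 A B = 1 := by
    rw [QuantumEntropy.sandwichedQuasi_one hA.posSemidef.1 hB.posSemidef.1, hA.trace_eq_one,
      Complex.one_re]
  have h := (QuantumEntropy.hasDerivWithinAt_sandwichedQuasi hA.posSemidef hB.posSemidef hAB).log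
    (by rw [h1]; exact one_ne_zero)
  rw [hasDerivWithinAt_iff_tendsto_slope' (by simp), h1, div_one] at h
  convert! h using 1
  ext t
  rw [slope_def_field, h1, Real.log_one, sub_zero, QuantumEntropy.sandwichedRenyi]
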